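/- Let $n > 3$ and let $G$ be a subgroup of the symmetric group $S_n$. Let $A$ be a finite set with $q := |A| \ge 2$. Let $A^G$ be the set of all maps $x : G \to A$, with the product topology of the discrete topology on $A$ and the shift action $(g\cdot x)(h) = x(g^{-1}h)$. Let $\mathrm{End}(A^G)$ be the monoid, under composition, of all continuous maps $\tau : A^G \to A^G$ with $\tau(g\cdot x) = g\cdot\tau(x)$ for all $g\in G$, $x \in A^G$, and let $\mathrm{Aut}(A^G)$ be its group of units. For a monoid $M$, let $\mathrm{Rank}(M)$ be the minimal cardinality of a subset that generates $M$ as a monoid. Let $r$ be the number of conjugacy classes in $G$ of subgroups of $G$, and $r_2$ the number of conjugacy classes of subgroups of index $2$ in $G$. Then $\mathrm{Rank}(\mathrm{Aut}(A^G))$ is finite and $$\mathrm{Rank}(\mathrm{Aut}(A^G)) \le \begin{cases} (r-1)\left\lfloor \frac n2 \right\rfloor + 2r - r_2 - 1 & \text{if } q = 2,\\ (r-1)\left\lfloor \frac n2 \right\rfloor + 2r & \text{if } q \ge 3.\end{cases}$$ -/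

import Mathlib

namespace FullShift

section Shift

variable (G A : Type*) [Group G]

/-- The full shift `A^G`: the set of all configurations `x : G → A`. -/
abbrev Config : Type _ := G → A

variable {G A} in
/-- The shift action of `G` on `A^G`: `(g · x) (h) = x (g⁻¹ h)`. -/
def shift (g : G) (x : Config G A) : Config G A := fun h => x (g⁻¹ * h)

/-- The prodiscrete topology on `A^G`: the product topology of the discrete topology on `A`. -/
abbrev prodiscrete : TopologicalSpace (Config G A) :=
  @Pi.topologicalSpace G (fun _ => A) (fun _ => ⊥)

/-- The monoid `End(A^G)` of continuous shift commuting self-maps of `A^G`, under composition. -/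
def ShiftEnd : Submonoid (Function.End (Config G A)) where
  carrier := {τ | @Continuous _ _ (prodiscrete G A) (prodiscrete G A) τ ∧
    ∀ (g : G) (x : Config G A), τ (shift g x) = shift g (τ x)}
  one_mem' := ⟨@continuous_id _ (prodiscrete G A), fun _ _ => rfl⟩
  mul_mem' := by
    rintro σ τ ⟨hσ, hσ'⟩ ⟨hτ, hτ'⟩
    refine ⟨@Continuous.comp _ _ _ (prodiscrete G A) (prodiscrete G A) (prodiscrete G A)
      _ _ hσ hτ, fun g x => ?_⟩
    change σ (τ (shift g x)) = shift g (σ (τ x))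
    rw [hτ', hσ']

/-- The group `Aut(A^G)` of units of `End(A^G)`. -/
abbrev ShiftAut : Type _ := (ShiftEnd G A)ˣ

end Shift

/-- The rank of a monoid: the minimal cardinality of a set that generates it as a monoid
(equal to `⊤` when there is no finite generating set). -/
noncomputable def rank (M : Type*) [Monoid M] : ℕ∞ :=
  sInf {c : ℕ∞ | ∃ T : Set M, Submonoid.closure T = ⊤ ∧ T.encard = c}

section ConjugacyClasses

variable (G : Type*) [Group G]

/-- Conjugacy of subgroups: `H₁ ∼ H₂` if `g⁻¹ H₁ g = H₂` for some `g`. -/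
def subgroupConj : Setoid (Subgroup G) where
  r H₁ H₂ := ∃ g : G, H₁.map (MulAut.conj g⁻¹).toMonoidHom = H₂
  iseqv :=
    { refl := fun H => ⟨1, by ext x; simp⟩
      symm := by
        rintro H _ ⟨g, rfl⟩
        refine ⟨g⁻¹, ?_⟩
        ext x
        simp [mul_assoc]
      trans := by
        rintro H _ _ ⟨g, rfl⟩ ⟨k, rfl⟩
        refine ⟨g * k, ?_⟩
        ext x
        simp [mul_assoc] }

/-- The conjugacy classes `[H]` of subgroups `H ≤ G`. -/
def SubgroupClass : Type _ := Quotient (subgroupConj G)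

/-- `r(G)`: the number of conjugacy classes of subgroups of a finite group `G`. -/
noncomputable def numClasses : ℕ := Nat.card (SubgroupClass G)

/-- `r_i(G)`: the number of conjugacy classes `[H]` of subgroups of index `i` in a
finite group `G`. -/
noncomputable def numClassesOfIndex (i : ℕ) : ℕ :=
  Nat.card {c : SubgroupClass G // ∃ H : Subgroup G, H.index = i ∧ Quotient.mk (subgroupConj G) H = c}

end ConjugacyClasses

end FullShift

namespace FullShift

/-! As `G` is finite, continuity is automatic, and `Aut(A^G)` is the group of equivariant
permutations of the finite `G`-set `A^G`. Such a permutation preserves stabilizers and is determined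
by its values on orbit representatives. So `Aut(A^G)` is an image of the product, over the classes
`[H]` of subgroups, of the wreath products of `K = N_G(H)/H` by the symmetric group on the orbits of
type `[H]` (`toHomUnits_surjective`). It is enough to generate each factor by `n/2 + 2` elements
(division rounded down), with some savings.

Two elements generate the symmetric group. If `K` has `n/2` generators, they can be placed in a
single coordinate. Otherwise `|K| ≥ 8`, and counting configurations gives more than `2|K|` orbits of
type `[H]` (`two_mul_card_normalizerQuotient_lt`). With so many coordinates, lifts of generators of
the abelianization of `K` suffice, because the spare coordinates can supply the commutator subgroup
(`eq_top_of_listing`). The abelianization needs at most `n/2` generators: if a permutation group of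
degree `n` has an abelian quotient of order `p ^ a`, then `2a ≤ n` (`card_sq_le_of_surjective`).

Savings: for `H = G` the group `K` is trivial and two generators suffice, or one if `q = 2`. For `H`
of index 2, `|K| ≤ 2` and three generators suffice, at most `n/2 + 1` since `n ≥ 4`. -/

/-- The group `M` is generated by at most `d` elements. -/
def GenLE (M : Type*) [Group M] (d : ℕ) : Prop :=
  ∃ T : Finset M, T.card ≤ d ∧ Subgroup.closure (T : Set M) = ⊤

/-! ### Generating sets of finite groups -/

section Generation

variable {M N : Type*} [Group M] [Group N]

theorem GenLE.mono {d e : ℕ} (h : GenLE M d) (hde : d ≤ e) : GenLE M e := by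
  obtain ⟨T, hT, hc⟩ := h
  exact ⟨T, hT.trans hde, hc⟩

theorem GenLE.of_surjective {d : ℕ} (h : GenLE M d) (f : M →* N)
    (hf : Function.Surjective f) : GenLE N d := by
  classical
  obtain ⟨T, hT, hc⟩ := h
  refine ⟨T.image f, Finset.card_image_le.trans hT, ?_⟩
  rw [Finset.coe_image, ← MonoidHom.map_closure, hc, Subgroup.map_top_of_surjective f hf]

theorem GenLE.of_family {ι : Type*} [Fintype ι] (u : ι → M)
    (hu : Subgroup.closure (Set.range u) = ⊤) : GenLE M (Fintype.card ι) := by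
  classical
  exact ⟨Finset.univ.image u, Finset.card_image_le, by simpa using hu⟩

theorem GenLE.exists_family {d : ℕ} (h : GenLE M d) :
    ∃ u : Fin d → M, Subgroup.closure (Set.range u) = ⊤ := by
  obtain ⟨T, hT, hc⟩ := h
  let e := T.equivFin
  refine ⟨fun i => if hi : (i : ℕ) < T.card then (e.symm ⟨i, hi⟩ : M) else 1, ?_⟩
  rw [eq_top_iff, ← hc, Subgroup.closure_le]
  intro t ht
  apply Subgroup.subset_closure
  refine ⟨⟨e ⟨t, ht⟩, (e ⟨t, ht⟩).2.trans_le hT⟩, ?_⟩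
  simp

theorem GenLE.of_subsingleton [Subsingleton M] (d : ℕ) : GenLE M d :=
  ⟨∅, by simp, Subsingleton.elim _ _⟩

theorem genLE_of_finite [Finite M] : ∃ d, GenLE M d := by
  have := Fintype.ofFinite M
  exact ⟨_, Finset.univ, le_rfl, by simp⟩

/-- A finite group of order at least `p ^ d`, where `p` is at most every prime divisor of the order,
has `d` generators. -/
theorem exists_genLE_pow_le [Finite M] (p : ℕ) (hp : 0 < p)
    (h : ∀ l : ℕ, l.Prime → l ∣ Nat.card M → p ≤ l) :
    ∃ d, GenLE M d ∧ p ^ d ≤ Nat.card M := by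
  classical
  have key : ∀ k : ℕ, ∀ T : Finset M, p ^ T.card ≤ Nat.card (Subgroup.closure (T : Set M)) →
      (Subgroup.closure (T : Set M)).index ≤ k →
      ∃ T' : Finset M, p ^ T'.card ≤ Nat.card M ∧ Subgroup.closure (T' : Set M) = ⊤ := by
    intro k
    induction k with
    | zero =>
      intro T _ hk
      exact absurd (Nat.le_zero.1 hk) Subgroup.index_ne_zero_of_finite
    | succ k ih =>
      intro T hT hk
      by_cases htop : Subgroup.closure (T : Set M) = ⊤
      · refine ⟨T, ?_, htop⟩
        rw [htop] at hT
        simpa using hT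
      obtain ⟨g, hg⟩ : ∃ g, g ∉ Subgroup.closure (T : Set M) := by
        by_contra! hall
        exact htop ((Subgroup.eq_top_iff' _).2 hall)
      have hle : Subgroup.closure (T : Set M) ≤ Subgroup.closure ((insert g T : Finset M) : Set M) :=
        Subgroup.closure_mono (by simp)
      have hlt : Subgroup.closure (T : Set M) < Subgroup.closure ((insert g T : Finset M) : Set M) := by
        refine lt_of_le_of_ne hle fun heq => hg ?_
        rw [heq]
        exact Subgroup.subset_closure (by simp)
      have hidx := Subgroup.index_strictAnti hlt
      refine ih (insert g T) ?_ (by omega)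
      -- A new generator multiplies the order by this relative index; its prime divisors divide
      -- `|M|`, so it is at least `p`.
      have hrel : (Subgroup.closure (T : Set M)).relIndex
          (Subgroup.closure ((insert g T : Finset M) : Set M)) ≠ 1 := by
        rw [Ne, Subgroup.relIndex_eq_one]
        exact not_le_of_gt hlt
      obtain ⟨l, hl, hld⟩ := Nat.exists_prime_and_dvd hrel
      have hcard := Subgroup.relIndex_mul_relIndex ⊥ _ _ bot_le hle
      rw [Subgroup.relIndex_bot_left, Subgroup.relIndex_bot_left] at hcard
      have hpl : p ≤ (Subgroup.closure (T : Set M)).relIndex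
          (Subgroup.closure ((insert g T : Finset M) : Set M)) := by
        refine (h l hl ?_).trans (Nat.le_of_dvd ?_ hld)
        · refine hld.trans (Dvd.dvd.trans ?_ (Subgroup.card_subgroup_dvd_card
            (Subgroup.closure ((insert g T : Finset M) : Set M))))
          exact ⟨_, by rw [mul_comm]; exact hcard.symm⟩
        · rw [Nat.pos_iff_ne_zero]
          exact Subgroup.index_ne_zero_of_finite
      calc p ^ (insert g T).card ≤ p ^ (T.card + 1) :=
            Nat.pow_le_pow_right hp (Finset.card_insert_le _ _)
        _ = p ^ T.card * p := pow_succ _ _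
        _ ≤ _ := Nat.mul_le_mul hT hpl
        _ = _ := hcard
  obtain ⟨T, hT, hc⟩ := key _ ∅ (by simp) le_rfl
  exact ⟨T.card, ⟨T, le_rfl, hc⟩, hT⟩

theorem exists_genLE_two_pow_le [Finite M] : ∃ d, GenLE M d ∧ 2 ^ d ≤ Nat.card M :=
  exists_genLE_pow_le 2 two_pos fun _ hl _ => hl.two_le

theorem genLE_one_of_card_le_two [Finite M] (h : Nat.card M ≤ 2) : GenLE M 1 := by
  obtain ⟨d, hd, hc⟩ := exists_genLE_two_pow_le (M := M)
  refine hd.mono ?_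
  by_contra! hlt
  have := Nat.pow_le_pow_right two_pos hlt
  omega

theorem GenLE.pi {C : Type*} [Fintype C] {W : C → Type*} [∀ c, Group (W c)] {d : C → ℕ}
    (h : ∀ c, GenLE (W c) (d c)) : GenLE (∀ c, W c) (∑ c, d c) := by
  classical
  choose T hT hc using h
  refine ⟨Finset.univ.biUnion fun c => (T c).image (Pi.mulSingle c), ?_, ?_⟩
  · refine Finset.card_biUnion_le.trans (Finset.sum_le_sum fun c _ => ?_)
    exact Finset.card_image_le.trans (hT c)
  · rw [eq_top_iff]
    intro x _
    refine Subgroup.pi_mem_of_mulSingle_mem x fun c => ?_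
    have hx : x c ∈ Subgroup.closure (T c : Set (W c)) := by rw [hc]; trivial
    have := Subgroup.mem_map_of_mem (MonoidHom.mulSingle W c) hx
    rw [MonoidHom.map_closure] at this
    refine Subgroup.closure_mono ?_ this
    rintro _ ⟨t, ht, rfl⟩
    simp only [Finset.coe_biUnion, Set.mem_iUnion]
    exact ⟨c, Finset.mem_coe.2 (Finset.mem_univ _), by
      rw [Finset.coe_image]; exact ⟨t, ht, rfl⟩⟩

theorem genLE_perm (I : Type*) [Finite I] : GenLE (Equiv.Perm I) 2 := by
  classical
  have fin : ∀ n : ℕ, GenLE (Equiv.Perm (Fin n)) 2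
    | 0 => GenLE.of_subsingleton 2
    | 1 => GenLE.of_subsingleton 2
    | n + 2 => ⟨{finRotate (n + 2), Equiv.swap 0 (finRotate (n + 2) 0)}, Finset.card_le_two, by
        rw [Finset.coe_pair]
        exact Equiv.Perm.closure_cycle_adjacent_swap isCycle_finRotate
          (by rw [support_finRotate]) 0⟩
  let e := (Finite.equivFin I).symm
  exact (fin _).of_surjective e.permCongrHom.toMonoidHom e.permCongrHom.surjective

/-- In a finite group inverses are positive powers, so group generators are monoid generators. -/
theorem rank_le_of_genLE [Finite M] {d : ℕ} (h : GenLE M d) : rank M ≤ d := by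
  obtain ⟨T, hT, hc⟩ := h
  have hr : rank M ≤ (T : Set M).encard := by
    refine sInf_le ⟨(T : Set M), ?_, rfl⟩
    rw [← Subgroup.closure_toSubmonoid_of_finite, hc, Subgroup.top_toSubmonoid]
  refine hr.trans ?_
  rw [Set.encard_coe_eq_coe_finsetCard]
  exact_mod_cast hT

end Generation

/-! ### Generators of wreath products by symmetric groups -/

section Wreath

variable {I K : Type*} [Group K]

theorem commutator_le_of_closure {D : Subgroup K} [D.Normal] {X : Set K}
    (hX : Subgroup.closure X = ⊤) (h : ∀ a ∈ X, ∀ b ∈ X, a * b * a⁻¹ * b⁻¹ ∈ D) :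
    commutator K ≤ D := by
  have comm : ∀ a b : K, (a : K ⧸ D) * b = b * a ↔ a * b * a⁻¹ * b⁻¹ ∈ D := by
    intro a b
    rw [← QuotientGroup.mk_mul, ← QuotientGroup.mk_mul, eq_comm, QuotientGroup.eq,
      ‹D.Normal›.mem_comm_iff]
    simp [mul_assoc]
  have step : ∀ a : K, (∀ b ∈ X, (a : K ⧸ D) * b = b * a) →
      ∀ b : K, (a : K ⧸ D) * b = b * a := by
    intro a ha b
    have hle : Subgroup.closure X ≤
        (Subgroup.centralizer {(a : K ⧸ D)}).comap (QuotientGroup.mk' D) := by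
      rw [Subgroup.closure_le]
      intro b hb
      simpa [Subgroup.mem_centralizer_iff] using ha b hb
    rw [hX] at hle
    simpa [Subgroup.mem_centralizer_iff] using hle (Subgroup.mem_top b)
  have hall : ∀ a b : K, (a : K ⧸ D) * b = b * a := fun a =>
    step a fun b hb => (step b (fun c hc => (comm _ _).2 (h b hb c hc)) a).symm
  rw [commutator_def, Subgroup.commutator_le]
  intro a _ b _
  exact (comm a b).1 (hall a b)

/-- A subgroup of `K^I` that is stable under permutations of the coordinates contains all of `K^I`
as soon as it contains enough elements with one prescribed coordinate and the remaining
coordinates listing the commutator subgroup of `K`. -/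
theorem eq_top_of_listing [Finite I] [DecidableEq I] {B : Subgroup (I → K)}
    (hB : ∀ σ : Equiv.Perm I, ∀ f ∈ B, f ∘ σ ∈ B) {i₀ : I}
    (e : commutator K ⊕ commutator K ↪ I) (he : ∀ k, e k ≠ i₀)
    {ι : Type*} [Nonempty ι] (u : ι → K)
    (hu : Subgroup.closure (Set.range u) ⊔ commutator K = ⊤)
    (b : ι → I → K) (hb₀ : ∀ j, b j i₀ = u j) (hb₁ : ∀ j k, b j (e (Sum.inl k)) = k)
    (hb₂ : ∀ j i, i ≠ i₀ → (∀ k, e (Sum.inl k) ≠ i) → b j i = 1) (hbB : ∀ j, b j ∈ B) :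
    B = ⊤ := by
  -- `π` fixes `i₀` and exchanges the block carrying the listing with a disjoint block where every
  -- `b j` is trivial.
  let π : Equiv.Perm I := Equiv.Perm.viaEmbedding (Equiv.sumComm (commutator K) (commutator K)) e
  have hπ₀ : π i₀ = i₀ := Equiv.Perm.viaEmbedding_apply_of_notMem _ _ _ (by
    rintro ⟨k, hk⟩; exact he k hk)
  have hπ₁ : ∀ k, π (e (Sum.inl k)) = e (Sum.inr k) := fun k =>
    Equiv.Perm.viaEmbedding_apply _ _ _
  let S : Set I := {i | i = i₀ ∨ ∃ k, e (Sum.inl k) = i}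
  have hbS : ∀ j i, i ∉ S → b j i = 1 := fun j i hi =>
    hb₂ j i (fun h => hi (Or.inl h)) fun k hk => hi (Or.inr ⟨k, hk⟩)
  let D : Subgroup K := B.comap (MonoidHom.mulSingle (fun _ : I => K) i₀)
  have hD : ∀ k, k ∈ D ↔ Pi.mulSingle i₀ k ∈ B := fun k => Iff.rfl
  have hmove : ∀ k ∈ D, ∀ i, Pi.mulSingle i k ∈ B := by
    intro k hk i
    have := hB (Equiv.swap i₀ i) _ ((hD k).1 hk)
    convert this using 1
    ext i'
    simp only [Function.comp, Pi.mulSingle_apply]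
    by_cases h : i' = i
    · simp [h]
    · rw [if_neg h, if_neg]
      intro h'
      rw [Equiv.swap_apply_eq_iff] at h'
      simp at h'
      exact h h'
  -- Swapping `i₀` with a point of `S` preserves `S`, so every listed commutator can be brought to
  -- `i₀` without enlarging the support.
  have hval : ∀ j, ∀ s ∈ S, ∃ f ∈ B, f i₀ = b j s ∧ ∀ i, i ∉ S → f i = 1 := by
    intro j s hs
    refine ⟨_, hB (Equiv.swap i₀ s) _ (hbB j), by simp, fun i hi => ?_⟩
    have h1 : i ≠ i₀ := fun h => hi (Or.inl h)
    have h2 : i ≠ s := fun h => hi (h ▸ hs)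
    simp only [Function.comp, Equiv.swap_apply_of_ne_of_ne h1 h2]
    exact hbS j i hi
  let X : Set K := {k | ∃ f ∈ B, f i₀ = k ∧ ∀ i, i ∉ S → f i = 1}
  have hXu : Set.range u ⊆ X := by
    rintro _ ⟨j, rfl⟩
    exact ⟨b j, hbB j, hb₀ j, hbS j⟩
  have hXc : (commutator K : Set K) ⊆ X := by
    intro k hk
    obtain ⟨j⟩ := ‹Nonempty ι›
    obtain ⟨f, hf, h1, h2⟩ := hval j (e (Sum.inl ⟨k, hk⟩)) (Or.inr ⟨_, rfl⟩)
    exact ⟨f, hf, by rw [h1, hb₁], h2⟩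
  have hXtop : Subgroup.closure X = ⊤ := by
    rw [eq_top_iff, ← hu, sup_le_iff]
    refine ⟨Subgroup.closure_mono hXu, fun k hk => Subgroup.subset_closure (hXc hk)⟩
  have hproj : ∀ x : K, ∃ f ∈ B, f i₀ = x := by
    have : B.map (Pi.evalMonoidHom (fun _ : I => K) i₀) = ⊤ := by
      rw [eq_top_iff, ← hXtop, Subgroup.closure_le]
      rintro _ ⟨f, hf, rfl, _⟩
      exact ⟨f, hf, rfl⟩
    intro x
    have hx : x ∈ B.map (Pi.evalMonoidHom (fun _ : I => K) i₀) := by rw [this]; trivial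
    exact hx
  have hDn : D.Normal := by
    refine ⟨fun k hk x => ?_⟩
    obtain ⟨f, hf, rfl⟩ := hproj x
    rw [hD] at hk ⊢
    convert B.mul_mem (B.mul_mem hf hk) (B.inv_mem hf) using 1
    ext i
    by_cases h : i = i₀
    · subst h; simp
    · simp [Pi.mulSingle_eq_of_ne h]
  have hcomm : commutator K ≤ D := by
    refine commutator_le_of_closure hXtop ?_
    rintro _ ⟨f, hf, rfl, hfS⟩ _ ⟨g, hg, rfl, hgS⟩
    rw [hD]
    -- The supports of `f` and `g ∘ π` meet at most in `i₀`, so their commutator lives on that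
    -- coordinate alone.
    have hg' := hB π g hg
    convert B.mul_mem (B.mul_mem (B.mul_mem hf hg') (B.inv_mem hf)) (B.inv_mem hg') using 1
    ext i
    by_cases h : i = i₀
    · subst h; simp [hπ₀]
    · rw [Pi.mulSingle_eq_of_ne h]
      by_cases hi : i ∈ S
      · obtain ⟨k, rfl⟩ := hi.resolve_left h
        have : g (e (Sum.inr k)) = 1 := by
          refine hgS _ ?_
          rintro (h | ⟨k', h⟩)
          · exact he _ h
          · exact Sum.inl_ne_inr (e.injective h)
        simp [hπ₁, this]
      · simp [hfS i hi]
  have hDtop : D = ⊤ := by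
    rw [eq_top_iff, ← hu, sup_le_iff, Subgroup.closure_le]
    refine ⟨?_, hcomm⟩
    rintro _ ⟨j, rfl⟩
    -- Away from `i₀` all coordinates of `b j` are commutator elements, already known to lie in `B`;
    -- stripping them isolates `u j`.
    have hrest : b j * (Pi.mulSingle i₀ (u j))⁻¹ ∈ B := by
      refine Subgroup.pi_mem_of_mulSingle_mem _ fun i => hmove _ (hcomm ?_) i
      by_cases h : i = i₀
      · subst h; simp [hb₀]
      · by_cases hi : ∃ k, e (Sum.inl k) = i
        · obtain ⟨k, rfl⟩ := hi
          simp [Pi.mulSingle_eq_of_ne h, hb₁]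
        · push Not at hi
          simp [Pi.mulSingle_eq_of_ne h, hb₂ j i h hi]
    have := B.mul_mem (B.inv_mem hrest) (hbB j)
    simpa [hD] using this
  rw [eq_top_iff]
  intro f _
  refine Subgroup.pi_mem_of_mulSingle_mem f fun i => hmove _ ?_ i
  rw [hDtop]; trivial

variable (I K) in
/-- The wreath product of `K` by the symmetric group on `I`. -/
abbrev SymWreath : Type _ := (I → K) ⋊[mulAutArrow] Equiv.Perm I

theorem symWreath_conj (σ : Equiv.Perm I) (f : I → K) :
    (SemidirectProduct.inr σ⁻¹ * SemidirectProduct.inl f * SemidirectProduct.inr σ : SymWreath I K)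
      = SemidirectProduct.inl (f ∘ σ) := by
  rw [← SemidirectProduct.inl_aut_inv]
  congr 1

/-- The two extra generators produce all of `Perm I`, whose conjugation action permutes coordinates;
hence the base part of the generated subgroup is stable under permutations. -/
theorem genLE_symWreath_of_base {d : ℕ} {L : Finset (I → K)} (hL : L.card ≤ d)
    [Finite I]
    (h : ∀ B : Subgroup (I → K), (∀ σ : Equiv.Perm I, ∀ f ∈ B, f ∘ σ ∈ B) →
      (∀ f ∈ L, f ∈ B) → B = ⊤) : GenLE (SymWreath I K) (d + 2) := by
  classical
  obtain ⟨T, hT, hTc⟩ := genLE_perm I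
  refine ⟨L.image SemidirectProduct.inl ∪ T.image SemidirectProduct.inr, ?_, ?_⟩
  · exact (Finset.card_union_le _ _).trans
      (add_le_add (Finset.card_image_le.trans hL) (Finset.card_image_le.trans hT))
  set Γ := Subgroup.closure ((L.image SemidirectProduct.inl ∪ T.image SemidirectProduct.inr :
    Finset (SymWreath I K)) : Set (SymWreath I K)) with hΓ
  have hinr : ∀ σ : Equiv.Perm I, (SemidirectProduct.inr σ : SymWreath I K) ∈ Γ := by
    have : Γ.comap SemidirectProduct.inr = ⊤ := by
      rw [eq_top_iff, ← hTc, Subgroup.closure_le]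
      intro t ht
      refine Subgroup.subset_closure ?_
      rw [Finset.coe_union, Finset.coe_image, Finset.coe_image]
      exact Or.inr ⟨t, ht, rfl⟩
    intro σ
    have hσ : σ ∈ Γ.comap SemidirectProduct.inr := by rw [this]; trivial
    exact hσ
  have hinl : Γ.comap SemidirectProduct.inl = ⊤ := by
    refine h _ (fun σ f hf => ?_) fun f hf => ?_
    · rw [Subgroup.mem_comap, ← symWreath_conj]
      exact Γ.mul_mem (Γ.mul_mem (hinr _) hf) (hinr _)
    · refine Subgroup.subset_closure ?_
      rw [Finset.coe_union, Finset.coe_image, Finset.coe_image]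
      exact Or.inl ⟨f, hf, rfl⟩
  rw [eq_top_iff]
  intro x _
  rw [← SemidirectProduct.inl_left_mul_inr_right x]
  refine Γ.mul_mem ?_ (hinr _)
  have hx : x.left ∈ Γ.comap SemidirectProduct.inl := by rw [hinl]; trivial
  exact hx

theorem GenLE.symWreath [Finite I] {d : ℕ} (h : GenLE K d) : GenLE (SymWreath I K) (d + 2) := by
  classical
  obtain ⟨T, hT, hc⟩ := h
  rcases isEmpty_or_nonempty I with hI | ⟨⟨i₀⟩⟩
  · have : Subsingleton (SymWreath I K) := SemidirectProduct.equivProd.subsingleton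
    exact GenLE.of_subsingleton _
  refine genLE_symWreath_of_base (L := T.image (Pi.mulSingle i₀))
    (Finset.card_image_le.trans hT) fun B hB hL => ?_
  have hD : B.comap (MonoidHom.mulSingle (fun _ : I => K) i₀) = ⊤ := by
    rw [eq_top_iff, ← hc, Subgroup.closure_le]
    intro t ht
    exact hL _ (Finset.mem_image_of_mem _ ht)
  rw [eq_top_iff]
  intro f _
  refine Subgroup.pi_mem_of_mulSingle_mem f fun i => ?_
  have hk : f i ∈ B.comap (MonoidHom.mulSingle (fun _ : I => K) i₀) := by rw [hD]; trivial
  have := hB (Equiv.swap i₀ i) _ hk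
  convert this using 1
  ext i'
  simp only [Function.comp, MonoidHom.mulSingle_apply, Pi.mulSingle_apply]
  by_cases h : i' = i
  · simp [h]
  · rw [if_neg h, if_neg]
    intro h'
    rw [Equiv.swap_apply_eq_iff] at h'
    simp at h'
    exact h h'

theorem GenLE.symWreath_of_abelianization [Finite I] [Finite K] {d : ℕ}
    (h : GenLE (Abelianization K) d) (hd : 0 < d) (hI : 2 * Nat.card K < Nat.card I) :
    GenLE (SymWreath I K) (d + 2) := by
  classical
  obtain ⟨v, hv⟩ := h.exists_family
  choose u hu using fun j => QuotientGroup.mk'_surjective (commutator K) (v j)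
  have hgen : Subgroup.closure (Set.range u) ⊔ commutator K = ⊤ := by
    have h1 : (Subgroup.closure (Set.range u)).map Abelianization.of = ⊤ := by
      rw [MonoidHom.map_closure, ← hv, ← Set.range_comp]
      congr 2
      ext j
      exact hu j
    have h2 := Subgroup.comap_map_eq (Abelianization.of (G := K)) (Subgroup.closure (Set.range u))
    rw [h1, Subgroup.comap_top, Abelianization.ker_of] at h2
    exact h2.symm
  have hpos : 0 < Nat.card I := by omega
  obtain ⟨i₀⟩ : Nonempty I := (Nat.card_pos_iff.1 hpos).1
  have := Fintype.ofFinite I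
  have := Fintype.ofFinite K
  have := Fintype.ofFinite (commutator K)
  -- This uses `2|K| < |I|`: two disjoint copies of the commutator subgroup, and one more point
  -- `i₀`.
  obtain ⟨e⟩ : Nonempty (commutator K ⊕ commutator K ↪ {i // i ≠ i₀}) := by
    refine Function.Embedding.nonempty_of_card_le ?_
    have hK := Subgroup.card_le_card_group (commutator K)
    rw [Nat.card_eq_fintype_card, Nat.card_eq_fintype_card] at hK hI
    rw [Fintype.card_sum, Fintype.card_subtype_compl, Fintype.card_subtype_eq]
    omega
  let e' := e.trans (Function.Embedding.subtype _)
  have he' : ∀ k, e' k ≠ i₀ := fun k => (e k).2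
  let c : I → K := Function.extend (fun k => e' (Sum.inl k)) Subtype.val 1
  have hinj : Function.Injective fun k => e' (Sum.inl k) := e'.injective.comp Sum.inl_injective
  let b : Fin d → I → K := fun j => Function.update c i₀ (u j)
  have : Nonempty (Fin d) := ⟨⟨0, hd⟩⟩
  refine genLE_symWreath_of_base (L := Finset.univ.image b)
    (Finset.card_image_le.trans (by simp)) fun B hB hL => ?_
  refine eq_top_of_listing hB e' he' u hgen b (fun j => by simp [b]) (fun j k => ?_)
    (fun j i hi hk => ?_) fun j => hL _ (Finset.mem_image_of_mem _ (Finset.mem_univ _))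
  · simp only [b, Function.update_of_ne (he' _), c]
    exact hinj.extend_apply _ _ _
  · simp only [b, Function.update_of_ne hi, c]
    rw [Function.extend_apply' _ _ _ (by rintro ⟨k, hk'⟩; exact hk k hk')]
    rfl

end Wreath

/-! ### Abelian quotients of permutation groups -/

section PermutationGroups

open MulAction

theorem normal_of_commutator_le {P : Type*} [Group P] {R : Subgroup P} (h : commutator P ≤ R) :
    R.Normal := by
  refine ⟨fun r hr g => ?_⟩
  have h1 : g * r * g⁻¹ * r⁻¹ ∈ R :=
    h (Subgroup.commutator_mem_commutator (Subgroup.mem_top g) (Subgroup.mem_top r))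
  simpa using R.mul_mem h1 hr

/-- By Legendre's formula the 2-adic valuation of `n!` is `n` minus the binary digit sum. -/
theorem two_pow_dvd_factorial_lt {a n : ℕ} (hn : n ≠ 0) (h : 2 ^ a ∣ n.factorial) : a < n := by
  have h1 : a ≤ padicValNat 2 n.factorial :=
    (padicValNat_dvd_iff_le (Nat.factorial_ne_zero n)).1 h
  have h2 := sub_one_mul_padicValNat_factorial_lt_of_ne_zero 2 hn
  omega

/-- A proper point stabilizer lies in a subgroup `M` of index 2, whose orbit `Δ` of the point is
half of `Ω`. Let `C` be the kernel of `M` on `Δ`; then `|M : C| ≤ 2 ^ (N - 1)` with `N = |Δ|`, and a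
conjugate `C'` of `C` fixes the other half pointwise. As `P/R` is abelian, `C` and `C'` agree modulo
`K = R ⊓ M`, while `C ⊓ C'` acts trivially and so lies in `K`. Comparing indices gives `|M : K| ≤ |M
: C|`, hence `|P : R| ≤ 2 ^ N`. -/
theorem index_sq_le_of_isPretransitive {P Ω : Type*} [Group P] [Finite P] [Finite Ω] [Nonempty Ω]
    [MulAction P Ω] [IsPretransitive P Ω] (hP : IsPGroup 2 P) (R : Subgroup P)
    (hR : commutator P ≤ R) (hfix : ∀ p : P, (∀ w : Ω, p • w = w) → p ∈ R) :
    R.index ^ 2 ≤ 2 ^ Nat.card Ω := by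
  classical
  obtain ⟨w⟩ := ‹Nonempty Ω›
  have hRn : R.Normal := normal_of_commutator_le hR
  by_cases htop : stabilizer P w = ⊤
  · have : R = ⊤ := by
      rw [eq_top_iff]
      refine fun p _ => hfix p fun w' => ?_
      obtain ⟨g, rfl⟩ := exists_smul_eq P w w'
      have h1 : ∀ x : P, x • w = w := fun x => by
        rw [← mem_stabilizer_iff, htop]; trivial
      rw [h1, h1]
    simp [this, Nat.one_le_two_pow]
  obtain ⟨n, hn⟩ := IsPGroup.iff_card.1 hP
  obtain ⟨k, hk⟩ := IsPGroup.iff_card.1 (hP.to_subgroup (stabilizer P w))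
  have hkn : k < n := by
    have h1 := Subgroup.one_lt_index_of_ne_top htop
    have h2 := Subgroup.card_mul_index (stabilizer P w)
    rw [hk, hn] at h2
    by_contra! hle
    have h3 := Nat.pow_le_pow_right (n := 2) two_pos hle
    have h4 : 0 < 2 ^ k := by positivity
    nlinarith
  obtain ⟨M, hMcard, hM⟩ := Sylow.exists_subgroup_card_pow_prime_le 2 (n := k) (m := n - 1)
    (by rw [hn]; exact pow_dvd_pow 2 (by omega)) (stabilizer P w) hk (by omega)
  have hM2 : M.index = 2 := by
    have h2 := Subgroup.card_mul_index M
    obtain ⟨n, rfl⟩ : ∃ n', n = n' + 1 := ⟨n - 1, by omega⟩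
    rw [hMcard, hn, pow_succ] at h2
    exact Nat.eq_of_mul_eq_mul_left (by positivity) h2
  have hMn : M.Normal := Subgroup.normal_of_index_eq_two hM2
  set N := (stabilizer P w).relIndex M with hN
  have hNΩ : 2 * N = Nat.card Ω := by
    rw [← index_stabilizer_of_transitive P w, ← Subgroup.relIndex_mul_index hM, hM2, mul_comm]
  let Δ := orbit M w
  have hΔ : Nat.card Δ = N := by
    rw [Nat.card_coe_set_eq, ← index_stabilizer]
    rfl
  have hN0 : N ≠ 0 := by
    have : Nonempty Δ := ⟨⟨w, mem_orbit_self w⟩⟩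
    have : 0 < Nat.card Δ := Nat.card_pos
    omega
  let f := toPermHom M Δ
  let C : Subgroup P := f.ker.map M.subtype
  have hCM : C ≤ M := Subgroup.map_subtype_le _
  have hCmem : ∀ c ∈ C, ∀ m ∈ M, c • m • w = m • w := by
    rintro _ ⟨c, hc, rfl⟩ m hm
    have := Equiv.Perm.congr_fun (MonoidHom.mem_ker.1 hc) ⟨m • w, ⟨⟨m, hm⟩, rfl⟩⟩
    exact congrArg Subtype.val this
  have hCle : C.relIndex M ≤ 2 ^ (N - 1) := by
    have h1 : C.relIndex M = Nat.card f.range := by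
      rw [Subgroup.relIndex, Subgroup.subgroupOf,
        Subgroup.comap_map_eq_self_of_injective M.subtype_injective, Subgroup.index_ker]
    obtain ⟨a, ha⟩ := IsPGroup.iff_card.1 ((hP.to_subgroup M).of_surjective f.rangeRestrict
      f.rangeRestrict_surjective)
    have h2 : 2 ^ a ∣ N.factorial := by
      rw [← ha, ← hΔ, ← Nat.card_perm]
      exact Subgroup.card_subgroup_dvd_card _
    rw [h1, ha]
    exact Nat.pow_le_pow_right two_pos (Nat.le_sub_one_of_lt (two_pow_dvd_factorial_lt hN0 h2))
  obtain ⟨g, hg⟩ : ∃ g, g ∉ M := by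
    by_contra! hall
    rw [(Subgroup.eq_top_iff' M).2 hall, Subgroup.index_top] at hM2
    omega
  let C' := C.map (MulAut.conj g).toMonoidHom
  let K := R ⊓ M
  let L := C ⊔ K
  have hLM : L ≤ M := sup_le hCM inf_le_right
  have hKconj : K.map (MulAut.conj g).toMonoidHom = K := by
    ext x
    constructor
    · rintro ⟨y, hy, rfl⟩
      exact (inferInstance : K.Normal).conj_mem y hy g
    · intro hx
      refine ⟨g⁻¹ * x * g, ?_, by simp [mul_assoc]⟩
      simpa using (inferInstance : K.Normal).conj_mem x hx g⁻¹
  have hC'L : C' ≤ L := by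
    rintro _ ⟨c, hc, rfl⟩
    have h1 : g * c * g⁻¹ * c⁻¹ ∈ K :=
      ⟨hR (Subgroup.commutator_mem_commutator (Subgroup.mem_top g) (Subgroup.mem_top c)),
        M.mul_mem (hMn.conj_mem c (hCM hc) g) (M.inv_mem (hCM hc))⟩
    have h2 := L.mul_mem (Subgroup.mem_sup_right h1) (Subgroup.mem_sup_left hc)
    simpa using h2
  have hCC' : C ⊓ C' ≤ K := by
    rintro _ ⟨hx, c, hc, rfl⟩
    refine ⟨hfix _ fun w' => ?_, hCM hx⟩
    obtain ⟨p, rfl⟩ := exists_smul_eq P w w'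
    by_cases hp : p ∈ M
    · exact hCmem _ hx p hp
    · have hgp : g⁻¹ * p ∈ M := by
        rw [Subgroup.mul_mem_iff_of_index_two hM2, inv_mem_iff]
        exact ⟨fun h => absurd h hg, fun h => absurd h hp⟩
      have := hCmem c hc _ hgp
      simp only [mul_smul] at this
      simp [mul_smul, this]
  -- Conjugation by `g` fixes `K` and takes `C` to `C'`, which lies in `L` and meets `C` inside `K`.
  have h1 : K.relIndex C ≤ C.relIndex L := by
    calc K.relIndex C = (K.map (MulAut.conj g).toMonoidHom).relIndex C' :=
          (Subgroup.relIndex_map_map_of_injective _ _ (MulAut.conj g).injective).symm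
      _ = K.relIndex C' := by rw [hKconj]
      _ ≤ (C ⊓ C').relIndex C' := Subgroup.relIndex_le_of_le_left hCC' Subgroup.index_ne_zero_of_finite
      _ = C.relIndex C' := Subgroup.inf_relIndex_right _ _
      _ ≤ C.relIndex L := Subgroup.relIndex_le_of_le_right hC'L Subgroup.index_ne_zero_of_finite
  have h2 : K.relIndex M ≤ C.relIndex M := by
    rw [← Subgroup.relIndex_mul_relIndex K L M le_sup_right hLM,
      ← Subgroup.relIndex_mul_relIndex C L M le_sup_left hLM, Subgroup.relIndex_sup_right]
    exact Nat.mul_le_mul_right _ h1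
  have h3 : R.index ≤ 2 ^ N := by
    calc R.index ≤ K.index := Subgroup.index_antitone inf_le_left
      _ = K.relIndex M * M.index := (Subgroup.relIndex_mul_index inf_le_right).symm
      _ ≤ 2 ^ (N - 1) * 2 := by rw [hM2]; exact Nat.mul_le_mul_right _ (h2.trans hCle)
      _ = 2 ^ N := by rw [← pow_succ]; congr 1; omega
  calc R.index ^ 2 ≤ (2 ^ N) ^ 2 := Nat.pow_le_pow_left h3 2
    _ = 2 ^ Nat.card Ω := by rw [← pow_mul, ← hNΩ, mul_comm]

/-- An abelian quotient of a `2`-group of permutations of `n` points has order at most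
`2 ^ (n / 2)`. -/
theorem index_sq_le_of_isPGroup_two {n : ℕ} : ∀ {P : Type*} {Ω : Type*} [Group P] [Finite P]
    [Finite Ω] [MulAction P Ω], IsPGroup 2 P → ∀ R : Subgroup P, commutator P ≤ R →
    (∀ p : P, (∀ w : Ω, p • w = w) → p ∈ R) → Nat.card Ω = n → R.index ^ 2 ≤ 2 ^ Nat.card Ω := by
  induction n using Nat.strong_induction_on with
  | _ n ih =>
  intro P Ω _ _ _ _ hP R hR hfix hn
  have hRn : R.Normal := normal_of_commutator_le hR
  rcases isEmpty_or_nonempty Ω with hΩ | ⟨⟨w⟩⟩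
  · have : R = ⊤ := (Subgroup.eq_top_iff' R).2 fun p => hfix p fun w => (hΩ.false w).elim
    simp [this]
  -- Split off one orbit: `|P : R| = |P : RC| |C : R ∩ C|`, where `P` is transitive on `O` and `C`
  -- is controlled by its action on the complement.
  let O := orbit P w
  let C := fixingSubgroup P O
  have hO : O.ncard + Oᶜ.ncard = Nat.card Ω := Set.ncard_add_ncard_compl O
  have hOpos : 0 < O.ncard := (Set.ncard_pos (Set.toFinite O)).2 ⟨w, mem_orbit_self w⟩
  have hcomp : Nat.card (SubMulAction.ofFixingSubgroup P O) = Oᶜ.ncard :=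
    Nat.card_coe_set_eq Oᶜ
  have h1 : (R ⊔ C).index ^ 2 ≤ 2 ^ O.ncard := by
    rw [← Nat.card_coe_set_eq]
    have : Nonempty O := ⟨⟨w, mem_orbit_self w⟩⟩
    refine index_sq_le_of_isPretransitive hP (R ⊔ C) (hR.trans le_sup_left) fun p hp => ?_
    refine Subgroup.mem_sup_right ((mem_fixingSubgroup_iff P).2 fun y hy => ?_)
    exact congrArg Subtype.val (hp ⟨y, hy⟩)
  have h2 : (R.subgroupOf C).index ^ 2 ≤ 2 ^ Oᶜ.ncard := by
    rw [← hcomp]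
    refine ih Oᶜ.ncard (by omega) (hP.to_subgroup C) (R.subgroupOf C) ?_ (fun c hc => ?_) hcomp
    · rw [commutator_def, Subgroup.commutator_le]
      intro a _ b _
      exact hR (Subgroup.commutator_mem_commutator (Subgroup.mem_top (a : P))
        (Subgroup.mem_top (b : P)))
    · refine hfix c fun y => ?_
      by_cases hy : y ∈ O
      · exact (mem_fixingSubgroup_iff P).1 c.2 y hy
      · exact congrArg Subtype.val (hc ⟨y, hy⟩)
  have h3 : R.index = (R.subgroupOf C).index * (R ⊔ C).index := by
    rw [← Subgroup.relIndex_mul_index (le_sup_left : R ≤ R ⊔ C), sup_comm,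
      Subgroup.relIndex_sup_right]
    rfl
  rw [h3, mul_pow, ← hO, add_comm, pow_add]
  exact Nat.mul_le_mul h2 h1

theorem card_sq_le_of_surjective {N Q Ω : Type*} [Group N] [Finite N] [CommGroup Q] [Finite Q]
    [Finite Ω] [MulAction N Ω] [FaithfulSMul N Ω] {p : ℕ} (hp : p.Prime) (hQ : IsPGroup p Q)
    (φ : N →* Q) (hφ : Function.Surjective φ) : Nat.card Q ^ 2 ≤ p ^ Nat.card Ω := by
  have := Fact.mk hp
  obtain ⟨a, ha⟩ := IsPGroup.iff_card.1 hQ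
  rcases hp.eq_two_or_odd' with rfl | hodd
  · obtain ⟨P⟩ : Nonempty (Sylow 2 N) := inferInstance
    let ψ : (P : Subgroup N) →* Q := φ.comp (P : Subgroup N).subtype
    -- A Sylow 2-subgroup covers `Q`: the index of its image is a power of 2 dividing an odd number.
    have hψ : ψ.range = ⊤ := by
      rw [← Subgroup.index_eq_one]
      have h1 : ψ.range.index ∣ (P : Subgroup N).index := by
        have := Subgroup.index_map_dvd (P : Subgroup N) hφ
        rwa [← Subgroup.range_subtype (P : Subgroup N), MonoidHom.map_range,
          Subgroup.range_subtype] at this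
      have h2 : ψ.range.index ∣ 2 ^ a := ha ▸ Subgroup.index_dvd_card _
      refine Nat.eq_one_of_dvd_coprimes ?_ h1 h2
      exact ((Nat.Prime.coprime_iff_not_dvd hp).2 P.not_dvd_index).symm.pow_right a
    have h := index_sq_le_of_isPGroup_two (Ω := Ω) P.isPGroup' ψ.ker
      (by
        rw [commutator_def, Subgroup.commutator_le]
        intro x _ y _
        rw [MonoidHom.mem_ker, map_commutatorElement, commutatorElement_eq_one_iff_mul_comm,
          mul_comm])
      (fun q hq => by
        have : q = 1 := Subtype.ext (FaithfulSMul.eq_of_smul_eq_smul (α := Ω) fun w => by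
          rw [Subgroup.coe_one, one_smul]; exact hq w)
        rw [this]; exact ψ.ker.one_mem) rfl
    rwa [Subgroup.index_ker, hψ, Subgroup.card_top] at h
  -- For odd `p`, Legendre's formula alone suffices: `a ≤ |Ω| / (p - 1) ≤ |Ω| / 2`.
  · have h1 : p ^ a ∣ (Nat.card Ω).factorial := by
      rw [← ha, ← Nat.card_perm]
      refine (Subgroup.card_dvd_of_surjective φ hφ).trans ?_
      exact Subgroup.card_dvd_of_injective (toPermHom N Ω) toPerm_injective
    have h2 : a ≤ padicValNat p (Nat.card Ω).factorial :=
      (padicValNat_dvd_iff_le (Nat.factorial_ne_zero _)).1 h1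
    have h3 := sub_one_mul_padicValNat_factorial (p := p) (Nat.card Ω)
    have h4 : 2 ≤ p - 1 := by
      obtain ⟨k, hk⟩ := hodd
      have := hp.two_le
      omega
    have h5 := Nat.mul_le_mul h4 h2
    rw [ha, ← pow_mul]
    exact Nat.pow_le_pow_right hp.pos (by omega)

/-- Generators modulo `p`-th powers for the various `p` are merged by the Chinese remainder theorem.
Modulo `p`-th powers for all relevant `p` at once, nothing but the whole group is generated. -/
theorem genLE_of_forall_prime {Q : Type*} [CommGroup Q] [Finite Q] {m : ℕ}
    (h : ∀ p : ℕ, p.Prime → GenLE (Q ⧸ (powMonoidHom p : Q →* Q).range) m) : GenLE Q m := by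
  classical
  have hv : ∀ p : ℕ, ∃ v : Fin m → Q, p.Prime →
      Subgroup.closure (Set.range fun j => (v j : Q ⧸ (powMonoidHom p : Q →* Q).range)) = ⊤ := by
    intro p
    by_cases hp : p.Prime
    · obtain ⟨v, hv⟩ := (h p hp).exists_family
      choose v' hv' using fun j => QuotientGroup.mk_surjective (v j)
      exact ⟨v', fun _ => by simpa only [hv'] using hv⟩
    · exact ⟨1, fun hp' => absurd hp' hp⟩
  choose v hv using hv
  let S := (Nat.card Q).primeFactors
  -- By Euler's theorem `e p` is 1 modulo `p`, and it is 0 modulo the other primes of `S`.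
  let e : ℕ → ℕ := fun p => (∏ l ∈ S.erase p, l) ^ p.totient
  let u : Fin m → Q := fun j => ∏ p ∈ S, v p j ^ e p
  have hpow : ∀ (l : ℕ) (x : Q), (x : Q ⧸ (powMonoidHom l : Q →* Q).range) ^ l = 1 := by
    intro l x
    rw [← QuotientGroup.mk_pow, QuotientGroup.eq_one_iff]
    exact ⟨x, rfl⟩
  have hu : ∀ l ∈ S, ∀ j, (u j : Q ⧸ (powMonoidHom l : Q →* Q).range) = v l j := by
    intro l hl j
    have hlp : l.Prime := Nat.prime_of_mem_primeFactors hl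
    have h1 : (u j : Q ⧸ (powMonoidHom l : Q →* Q).range) =
        ∏ p ∈ S, (v p j : Q ⧸ (powMonoidHom l : Q →* Q).range) ^ e p := by
      exact map_prod (QuotientGroup.mk' (powMonoidHom l : Q →* Q).range) _ _
    rw [h1, Finset.prod_eq_single_of_mem l hl]
    · have hcop : Nat.Coprime (∏ l' ∈ S.erase l, l') l := by
        refine Nat.Coprime.prod_left fun l' hl' => ?_
        exact (Nat.coprime_primes (Nat.prime_of_mem_primeFactors (Finset.mem_of_mem_erase hl'))
          hlp).2 (Finset.ne_of_mem_erase hl')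
      have h2 : e l ≡ 1 [MOD l] := Nat.ModEq.pow_totient hcop
      have h4 : e l ≡ 1 [MOD orderOf (v l j : Q ⧸ (powMonoidHom l : Q →* Q).range)] :=
        h2.of_dvd (orderOf_dvd_of_pow_eq_one (hpow l _))
      rw [pow_eq_pow_iff_modEq.2 h4, pow_one]
    · intro p hp hpl
      have h2 : l ∣ e p := by
        refine (Finset.dvd_prod_of_mem (fun l : ℕ => l) (Finset.mem_erase.2 ⟨hpl.symm, hl⟩)).trans ?_
        exact dvd_pow_self _ (Nat.totient_pos.2 (Nat.prime_of_mem_primeFactors hp).pos).ne'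
      obtain ⟨k, hk⟩ := h2
      rw [hk, pow_mul, hpow, one_pow]
  have hU : Subgroup.closure (Set.range u) = ⊤ := by
    set U := Subgroup.closure (Set.range u) with hUdef
    rw [← Subgroup.index_eq_one]
    by_contra hne
    obtain ⟨l, hl, hdvd⟩ := Nat.exists_prime_and_dvd hne
    have hlS : l ∈ S := Nat.mem_primeFactors.2
      ⟨hl, hdvd.trans (Subgroup.index_dvd_card U), Nat.card_pos.ne'⟩
    -- A surjective `l`-th power map on a finite group is injective, contradicting Cauchy's theorem
    -- in `Q ⧸ U`.
    have hsurj : Function.Surjective fun x : Q ⧸ U => x ^ l := by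
      intro x
      obtain ⟨x, rfl⟩ := QuotientGroup.mk_surjective x
      have h1 : (x : Q ⧸ (powMonoidHom l : Q →* Q).range) ∈
          U.map (QuotientGroup.mk' (powMonoidHom l : Q →* Q).range) := by
        have h2 : U.map (QuotientGroup.mk' (powMonoidHom l : Q →* Q).range) = ⊤ := by
          rw [hUdef, MonoidHom.map_closure, ← hv l hl, ← Set.range_comp]
          congr 2
          ext j
          exact hu l hlS j
        rw [h2]; trivial
      obtain ⟨y, hy, hyx⟩ := h1
      obtain ⟨z, hz⟩ := QuotientGroup.eq.1 hyx
      refine ⟨(z : Q ⧸ U), ?_⟩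
      have hz' : z ^ l = y⁻¹ * x := hz
      change (z : Q ⧸ U) ^ l = x
      rw [← QuotientGroup.mk_pow, hz', QuotientGroup.mk_mul, QuotientGroup.mk_inv,
        (QuotientGroup.eq_one_iff y).2 hy, inv_one, one_mul]
    have hinj := Finite.injective_iff_surjective.2 hsurj
    have := Fact.mk hl
    rw [Subgroup.index_eq_card] at hdvd
    obtain ⟨x, hx⟩ := exists_prime_orderOf_dvd_card' l hdvd
    have hx1 : x = 1 := hinj (by simp [← hx, pow_orderOf_eq_one])
    rw [hx1, orderOf_one] at hx
    exact hl.one_lt.ne hx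
  simpa using GenLE.of_family u hU

/-- The abelianization of a quotient of a group of permutations of `n` points is generated by
`n / 2` elements. -/
theorem genLE_abelianization {N K Ω : Type*} [Group N] [Finite N] [Group K] [Finite K]
    [Finite Ω] [MulAction N Ω] [FaithfulSMul N Ω] (φ : N →* K) (hφ : Function.Surjective φ) :
    GenLE (Abelianization K) (Nat.card Ω / 2) := by
  have hfin : Finite (Abelianization K) :=
    Finite.of_surjective _ (QuotientGroup.mk'_surjective (commutator K))
  refine genLE_of_forall_prime fun p hp => ?_
  let Q := Abelianization K ⧸ (powMonoidHom p : Abelianization K →* Abelianization K).range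
  have hQ : IsPGroup p Q := by
    intro x
    obtain ⟨x, rfl⟩ := QuotientGroup.mk_surjective x
    refine ⟨1, ?_⟩
    rw [pow_one, ← QuotientGroup.mk_pow, QuotientGroup.eq_one_iff]
    exact ⟨x, rfl⟩
  have := Fact.mk hp
  obtain ⟨a, ha⟩ := IsPGroup.iff_card.1 hQ
  obtain ⟨d, hd, hcard⟩ := exists_genLE_pow_le (M := Q) p hp.pos fun l hl hdvd => by
    rw [ha] at hdvd
    exact ((Nat.prime_dvd_prime_iff_eq hl hp).1 (hl.dvd_of_dvd_pow hdvd)).ge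
  let R := (powMonoidHom p : Abelianization K →* Abelianization K).range
  have hsq : Nat.card Q ^ 2 ≤ p ^ Nat.card Ω :=
    card_sq_le_of_surjective hp hQ
      (((QuotientGroup.mk' R).comp Abelianization.of).comp φ)
      (((QuotientGroup.mk'_surjective R).comp (f := Abelianization.of)
        (QuotientGroup.mk'_surjective (commutator K))).comp hφ)
  refine hd.mono ?_
  have h1 : p ^ (d * 2) ≤ p ^ Nat.card Ω := by
    rw [pow_mul]
    exact (Nat.pow_le_pow_left hcard 2).trans hsq
  have := (Nat.pow_le_pow_iff_right hp.one_lt).1 h1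
  omega

end PermutationGroups

/-! ### Equivariant bijections as elements of wreath products -/

section EquivariantMaps

open MulAction

/-- The quotient `N_G(H) / H`. -/
abbrev NormalizerQuotient {G : Type*} [Group G] (H : Subgroup G) : Type _ :=
  Subgroup.normalizer (H : Set G) ⧸ H.subgroupOf (Subgroup.normalizer (H : Set G))

variable {G X : Type*} [Group G] [MulAction G X]

/-- The right action of `N_G(H) / H` on the points with stabilizer `H`. -/
noncomputable def rightTranslate {H : Subgroup G} (k : NormalizerQuotient H) (x : X) : X :=
  (k.out : G)⁻¹ • x

theorem stabilizer_normalizer_smul {H : Subgroup G} {x : X} (hx : stabilizer G x = H)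
    {n : G} (hn : n ∈ Subgroup.normalizer (H : Set G)) : stabilizer G (n • x) = H := by
  rw [stabilizer_smul_eq_stabilizer_map_conj, hx]
  exact Subgroup.mem_normalizer_iff_map_conj_eq.1 hn

theorem rightTranslate_mk {H : Subgroup G} {x : X} (hx : stabilizer G x = H)
    (n : Subgroup.normalizer (H : Set G)) :
    rightTranslate (n : NormalizerQuotient H) x = (n : G)⁻¹ • x := by
  obtain ⟨⟨h, hh⟩, hn⟩ :=
    QuotientGroup.mk_out_eq_mul (H.subgroupOf (Subgroup.normalizer (H : Set G))) n
  have h1 : stabilizer G ((n : G)⁻¹ • x) = H :=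
    stabilizer_normalizer_smul hx (Subgroup.inv_mem _ n.2)
  have h2 : (h : G)⁻¹ ∈ stabilizer G ((n : G)⁻¹ • x) := by
    rw [h1]
    exact H.inv_mem hh
  rw [rightTranslate, hn, Subgroup.coe_mul, mul_inv_rev, mul_smul]
  exact h2

theorem stabilizer_rightTranslate {H : Subgroup G} {x : X} (hx : stabilizer G x = H)
    (k : NormalizerQuotient H) : stabilizer G (rightTranslate k x) = H :=
  stabilizer_normalizer_smul hx (Subgroup.inv_mem _ k.out.2)

/-- The inverse in `rightTranslate` reverses products; this is the order in which equivariant maps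
compose. -/
theorem rightTranslate_mul {H : Subgroup G} {x : X} (hx : stabilizer G x = H)
    (k l : NormalizerQuotient H) :
    rightTranslate (k * l) x = (l.out : G)⁻¹ • rightTranslate k x := by
  obtain ⟨n, rfl⟩ := QuotientGroup.mk_surjective k
  obtain ⟨m, rfl⟩ := QuotientGroup.mk_surjective l
  rw [← QuotientGroup.mk_mul, rightTranslate_mk hx, rightTranslate_mk hx, Subgroup.coe_mul,
    mul_inv_rev, mul_smul]
  exact (rightTranslate_mk (stabilizer_normalizer_smul hx (Subgroup.inv_mem _ n.2)) m).symm

theorem rightTranslate_one {H : Subgroup G} {x : X} (hx : stabilizer G x = H) :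
    rightTranslate (1 : NormalizerQuotient H) x = x := by
  simpa using rightTranslate_mk hx 1

variable (G X) in
/-- Representatives of the orbits of `G` on `X`, chosen so that orbits of the same type have
representatives with the same stabilizer. -/
structure OrbitReps (C : Type*) where
  /-- The stabilizer of the representatives of a given type. -/
  stab : C → Subgroup G
  /-- The orbits of a given type. -/
  orbits : C → Type*
  /-- The representatives. -/
  rep : ∀ c, orbits c → X
  stabilizer_rep : ∀ c i, stabilizer G (rep c i) = stab c
  exists_eq_smul : ∀ x, ∃ (g : G) (c : C) (i : orbits c), x = g • rep c i
  rep_injective : ∀ c i j (g : G), g • rep c i = rep c j → i = j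
  stab_injective : ∀ c d (g : G), (stab c).map (MulAut.conj g).toMonoidHom = stab d → c = d

namespace OrbitReps

variable {C : Type*} (S : OrbitReps G X C)

theorem ext_of_rep {σ τ : X → X} (hσ : ∀ (g : G) x, σ (g • x) = g • σ x)
    (hτ : ∀ (g : G) x, τ (g • x) = g • τ x) (h : ∀ c i, σ (S.rep c i) = τ (S.rep c i)) :
    σ = τ := by
  ext x
  obtain ⟨g, c, i, rfl⟩ := S.exists_eq_smul x
  rw [hσ, hτ, h]

theorem eq_of_smul_rep {c d : C} {i : S.orbits c} {j : S.orbits d} {g h : G}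
    (e : g • S.rep c i = h • S.rep d j) : (⟨c, i⟩ : Σ c, S.orbits c) = ⟨d, j⟩ := by
  have e' : (h⁻¹ * g) • S.rep c i = S.rep d j := by rw [mul_smul, e, inv_smul_smul]
  have hcd : c = d := by
    refine S.stab_injective c d (h⁻¹ * g) ?_
    rw [← S.stabilizer_rep c i, ← S.stabilizer_rep d j, ← e',
      stabilizer_smul_eq_stabilizer_map_conj]
  subst hcd
  rw [S.rep_injective c i j _ e']

theorem smul_eq_smul {y : ∀ c, S.orbits c → X} (hy : ∀ c i, S.stab c ≤ stabilizer G (y c i))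
    {c d : C} {i : S.orbits c} {j : S.orbits d} {g h : G}
    (e : g • S.rep c i = h • S.rep d j) : g • y c i = h • y d j := by
  cases S.eq_of_smul_rep e
  have h1 : h⁻¹ * g ∈ S.stab c := by
    rw [← S.stabilizer_rep c i, mem_stabilizer_iff, mul_smul, e, inv_smul_smul]
  have h2 := mem_stabilizer_iff.1 (hy c i h1)
  rwa [mul_smul, inv_smul_eq_iff] at h2

theorem exists_equivariant (y : ∀ c, S.orbits c → X)
    (hy : ∀ c i, S.stab c ≤ stabilizer G (y c i)) :
    ∃ τ : X → X, (∀ (g : G) x, τ (g • x) = g • τ x) ∧ ∀ c i, τ (S.rep c i) = y c i := by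
  choose g c i hx using S.exists_eq_smul
  refine ⟨fun x => g x • y (c x) (i x), fun k x => ?_, fun d j => ?_⟩
  · rw [← mul_smul]
    refine S.smul_eq_smul hy ?_
    rw [← hx, mul_smul, ← hx]
  · refine (S.smul_eq_smul hy (h := 1) ?_).trans (one_smul _ _)
    rw [← hx, one_smul]

/-- The product of the wreath products attached to the types of orbits. -/
abbrev WreathProd : Type _ :=
  ∀ c, SymWreath (S.orbits c) (NormalizerQuotient (S.stab c))

/-- The image of a representative under an element of the product of wreath products. -/
noncomputable def target (w : S.WreathProd) (c : C) (i : S.orbits c) : X :=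
  rightTranslate ((w c).left ((w c).right i)) (S.rep c ((w c).right i))

theorem stabilizer_target (w : S.WreathProd) (c : C) (i : S.orbits c) :
    stabilizer G (S.target w c i) = S.stab c :=
  stabilizer_rightTranslate (S.stabilizer_rep c _) _

/-- The equivariant map attached to an element of the product of wreath products. -/
noncomputable def equivariantMap (w : S.WreathProd) : X → X :=
  (S.exists_equivariant (S.target w) fun c i => (S.stabilizer_target w c i).ge).choose

theorem equivariantMap_smul (w : S.WreathProd) (g : G) (x : X) :
    S.equivariantMap w (g • x) = g • S.equivariantMap w x :=
  (S.exists_equivariant (S.target w) fun c i => (S.stabilizer_target w c i).ge).choose_spec.1 g x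

theorem equivariantMap_rightTranslate (w : S.WreathProd) {H : Subgroup G}
    (k : NormalizerQuotient H) (x : X) :
    S.equivariantMap w (rightTranslate k x) = (k.out : G)⁻¹ • S.equivariantMap w x :=
  S.equivariantMap_smul w _ x

theorem equivariantMap_rep (w : S.WreathProd) (c : C) (i : S.orbits c) :
    S.equivariantMap w (S.rep c i) = S.target w c i :=
  (S.exists_equivariant (S.target w) fun c i => (S.stabilizer_target w c i).ge).choose_spec.2 c i

theorem equivariantMap_one : S.equivariantMap 1 = id :=
  S.ext_of_rep (S.equivariantMap_smul 1) (fun _ _ => rfl) fun c i => by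
    rw [equivariantMap_rep]
    exact rightTranslate_one (S.stabilizer_rep c i)

theorem equivariantMap_mul (v w : S.WreathProd) :
    S.equivariantMap (v * w) = S.equivariantMap v ∘ S.equivariantMap w :=
  S.ext_of_rep (S.equivariantMap_smul _)
    (fun g x => by simp only [Function.comp, equivariantMap_smul]) fun c i => by
    rw [Function.comp, equivariantMap_rep, equivariantMap_rep, target, target,
      equivariantMap_rightTranslate, equivariantMap_rep, target,
      ← rightTranslate_mul (S.stabilizer_rep c _)]
    have h : mulAutArrow (v c).right (w c).left ((v c).right ((w c).right i)) =
        (w c).left ((w c).right i) := congrArg (w c).left ((v c).right.symm_apply_apply _)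
    rw [Pi.mul_apply, SemidirectProduct.mul_left, SemidirectProduct.mul_right, Pi.mul_apply,
      Equiv.Perm.mul_apply, h]

variable {E : Submonoid (Function.End X)} (hE : ∀ τ, τ ∈ E ↔ ∀ (g : G) x, τ (g • x) = g • τ x)

/-- The action of the product of wreath products by equivariant maps. -/
noncomputable def toEquivariant : S.WreathProd →* E where
  toFun w := ⟨S.equivariantMap w, (hE _).2 (S.equivariantMap_smul w)⟩
  map_one' := Subtype.ext S.equivariantMap_one
  map_mul' v w := Subtype.ext (S.equivariantMap_mul v w)

/-- A unit is injective, hence preserves stabilizers. It therefore moves each representative to a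
normalizer translate of a representative of the same type, and the induced injection of the finite
set of orbits is a permutation. -/
theorem toHomUnits_surjective [∀ c, Finite (S.orbits c)] :
    Function.Surjective (S.toEquivariant hE).toHomUnits := by
  intro u
  let τ : X → X := (u : E).1
  have hτ : ∀ (g : G) x, τ (g • x) = g • τ x := (hE τ).1 (u : E).2
  have hinj : Function.Injective τ := by
    have h1 : ((u⁻¹ : Eˣ) : E).1 ∘ τ = id := congrArg Subtype.val u.inv_mul
    exact Function.LeftInverse.injective (congrFun h1)
  have hstab : ∀ x, stabilizer G (τ x) = stabilizer G x := by
    intro x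
    ext g
    rw [mem_stabilizer_iff, mem_stabilizer_iff, ← hτ, hinj.eq_iff]
  have hrep : ∀ c i, ∃ (n : Subgroup.normalizer (S.stab c : Set G)) (j : S.orbits c),
      τ (S.rep c i) = (n : G) • S.rep c j := by
    intro c i
    obtain ⟨g, d, j, hg⟩ := S.exists_eq_smul (τ (S.rep c i))
    have h1 : (S.stab d).map (MulAut.conj g).toMonoidHom = S.stab c := by
      rw [← S.stabilizer_rep c i, ← hstab, hg, stabilizer_smul_eq_stabilizer_map_conj,
        S.stabilizer_rep]
    cases S.stab_injective d c g h1
    exact ⟨⟨g, Subgroup.mem_normalizer_iff_map_conj_eq.2 h1⟩, j, hg⟩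
  choose n s hns using hrep
  have hs : ∀ c, Function.Injective (s c) := by
    intro c i j hij
    refine S.rep_injective c i j ((n c j : G) * (n c i : G)⁻¹) (hinj ?_)
    rw [hτ, hns, hns, hij, mul_smul, inv_smul_smul]
  let σ : ∀ c, Equiv.Perm (S.orbits c) := fun c =>
    Equiv.ofBijective (s c) (Finite.injective_iff_bijective.1 (hs c))
  let w : S.WreathProd := fun c => ⟨fun j => (((n c ((σ c).symm j))⁻¹ :
    Subgroup.normalizer (S.stab c : Set G)) : NormalizerQuotient (S.stab c)), σ c⟩
  refine ⟨w, Units.ext (Subtype.ext ?_)⟩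
  refine S.ext_of_rep (S.equivariantMap_smul w) hτ fun c i => ?_
  change S.equivariantMap w (S.rep c i) = τ (S.rep c i)
  rw [equivariantMap_rep, target, rightTranslate_mk (S.stabilizer_rep c _)]
  have hσ : (σ c).symm ((w c).right i) = i := (σ c).symm_apply_apply i
  rw [hσ, hns]
  simp [w, σ]

end OrbitReps

end EquivariantMaps

/-! ### Counting orbits of configurations with a given stabilizer type -/

section Counting

open MulAction

/-- The chosen subgroup in a conjugacy class. -/
noncomputable def SubgroupClass.rep {G : Type*} [Group G] (c : SubgroupClass G) : Subgroup G :=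
  @Quotient.out _ (subgroupConj G) c

theorem exists_map_conj_eq_rep {G : Type*} [Group G] (H : Subgroup G) :
    ∃ g : G, H.map (MulAut.conj g).toMonoidHom =
      SubgroupClass.rep (Quotient.mk (subgroupConj G) H) := by
  obtain ⟨g, hg⟩ := (subgroupConj G).symm (Quotient.mk_out (s := subgroupConj G) H)
  exact ⟨g⁻¹, hg⟩

theorem SubgroupClass.rep_injective {G : Type*} [Group G] (c d : SubgroupClass G) (g : G)
    (h : c.rep.map (MulAut.conj g).toMonoidHom = d.rep) : c = d := by
  have h1 : (subgroupConj G).r c.rep d.rep := ⟨g⁻¹, by rwa [inv_inv]⟩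
  exact (Quotient.out_eq (s := subgroupConj G) c).symm.trans
    ((Quotient.sound (s := subgroupConj G) h1).trans (Quotient.out_eq (s := subgroupConj G) d))

theorem mem_orbit_of_smul_eq_smul {G X : Type*} [Group G] [MulAction G X] {a b : G} {x y : X}
    (h : a • x = b • y) : x ∈ orbit G y :=
  ⟨a⁻¹ * b, by simp only [mul_smul, ← h, inv_smul_smul]⟩

variable (G X : Type*) [Group G] [MulAction G X]

/-- Representatives of the orbits of `G` on `X`, indexed by conjugacy classes of subgroups. -/
noncomputable def orbitReps : OrbitReps G X (SubgroupClass G) where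
  stab := SubgroupClass.rep
  orbits c := {ω : orbitRel.Quotient G X // Quotient.mk (subgroupConj G) (stabilizer G ω.out) = c}
  rep _ ω := (exists_map_conj_eq_rep (stabilizer G ω.1.out)).choose • ω.1.out
  stabilizer_rep := by
    rintro _ ⟨ω, rfl⟩
    rw [stabilizer_smul_eq_stabilizer_map_conj]
    exact (exists_map_conj_eq_rep (stabilizer G ω.out)).choose_spec
  exists_eq_smul x := by
    let ω : orbitRel.Quotient G X := Quotient.mk (orbitRel G X) x
    obtain ⟨g, hg⟩ : ∃ g : G, g • ω.out = x :=
      mem_orbit_iff.1 (orbitRel_apply.1 (Quotient.exact (s := orbitRel G X) (Quotient.out_eq (s := orbitRel G X) ω).symm))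
    refine ⟨g * (exists_map_conj_eq_rep (stabilizer G ω.out)).choose⁻¹, _, ⟨ω, rfl⟩, ?_⟩
    rw [mul_smul, inv_smul_smul, hg]
  rep_injective := by
    rintro c ⟨ω, hω⟩ ⟨η, hη⟩ g h
    refine Subtype.ext ?_
    dsimp only at h
    rw [← mul_smul] at h
    exact Quotient.out_equiv_out.1 (mem_orbit_of_smul_eq_smul h)
  stab_injective := SubgroupClass.rep_injective

variable {G X}

theorem OrbitReps.ncard_stabilizer_eq_le [Finite G] [Finite X] {C : Type*} (S : OrbitReps G X C)
    (c : C) [Finite (S.orbits c)] : {x : X | stabilizer G x = S.stab c}.ncard ≤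
      Nat.card (S.orbits c) * Nat.card (NormalizerQuotient (S.stab c)) := by
  rw [← Nat.card_prod, ← Nat.card_coe_set_eq]
  let f : S.orbits c × NormalizerQuotient (S.stab c) → {x : X | stabilizer G x = S.stab c} :=
    fun p => ⟨rightTranslate p.2 (S.rep c p.1), stabilizer_rightTranslate (S.stabilizer_rep c _) _⟩
  refine Nat.card_le_card_of_surjective f ?_
  rintro ⟨x, hx⟩
  obtain ⟨g, d, j, rfl⟩ := S.exists_eq_smul x
  have h1 : (S.stab d).map (MulAut.conj g).toMonoidHom = S.stab c := by
    rw [← S.stabilizer_rep d j, ← stabilizer_smul_eq_stabilizer_map_conj]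
    exact hx
  cases S.stab_injective d c g h1
  have hg : g⁻¹ ∈ Subgroup.normalizer (S.stab c : Set G) :=
    Subgroup.inv_mem _ (Subgroup.mem_normalizer_iff_map_conj_eq.2 h1)
  refine ⟨(j, ((⟨g⁻¹, hg⟩ : Subgroup.normalizer (S.stab c : Set G)) :
    NormalizerQuotient (S.stab c))), Subtype.ext ?_⟩
  change rightTranslate _ (S.rep c j) = g • S.rep c j
  rw [rightTranslate_mk (S.stabilizer_rep c j), inv_inv]

theorem two_mul_sq_add_lt_pow {q t : ℕ} (hq : 2 ≤ q) (ht : 8 ≤ t) :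
    2 * t ^ 2 + (t - 1) * q ^ (t / 2) < q ^ t := by
  have hpow : ∀ s : ℕ, 4 ≤ s → 4 * s ≤ 2 ^ s := by
    intro s hs
    induction s, hs using Nat.le_induction with
    | base => norm_num
    | succ s hs ih => rw [pow_succ]; omega
  obtain ⟨s, hs⟩ := Nat.even_or_odd' t
  have hs4 : 4 ≤ s := by omega
  have hY : 4 * s ≤ q ^ s := (hpow s hs4).trans (Nat.pow_le_pow_left hq s)
  rcases hs with rfl | rfl
  · rw [show 2 * s / 2 = s by omega, mul_comm 2 s, pow_mul]
    obtain ⟨m, hm⟩ : ∃ m, s * 2 = m + 1 := ⟨s * 2 - 1, by omega⟩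
    rw [hm, Nat.add_sub_cancel, ← hm]
    generalize q ^ s = Y at *
    nlinarith
  · rw [show (2 * s + 1) / 2 = s by omega, Nat.add_sub_cancel, pow_succ q, mul_comm 2 s, pow_mul q]
    generalize q ^ s = Y at *
    have : Y ^ 2 * 2 ≤ Y ^ 2 * q := Nat.mul_le_mul_left _ hq
    nlinarith

attribute [local instance] arrowAction

theorem card_fixed_config [Finite G] {A : Type*} [Finite A] (H : Subgroup G) :
    {x : Config G A | H ≤ stabilizer G x}.ncard = Nat.card A ^ H.index := by
  rw [Subgroup.index_eq_card, ← Nat.card_fun, ← Nat.card_coe_set_eq]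
  -- Fixed configurations are constant on right cosets `Hg`; inversion turns these into the left
  -- cosets of `G ⧸ H`.
  let f : {x : Config G A | H ≤ stabilizer G x} → (G ⧸ H) → A := fun x a => x.1 a.out⁻¹
  have hx : ∀ (x : Config G A), H ≤ stabilizer G x → ∀ h ∈ H, ∀ g, x (h * g) = x g := by
    intro x hx h hh g
    have h1 : h⁻¹ • x = x := hx (H.inv_mem hh)
    have h2 := congrFun h1 g
    change x (h⁻¹⁻¹ * g) = x g at h2
    rwa [inv_inv] at h2
  refine Nat.card_eq_of_bijective f ⟨?_, ?_⟩
  · rintro ⟨x, hxH⟩ ⟨y, hyH⟩ hxy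
    refine Subtype.ext (funext fun g => ?_)
    obtain ⟨h, hh⟩ := QuotientGroup.mk_out_eq_mul H g⁻¹
    have h1 := congrFun hxy (g⁻¹ : G)
    simp only [f] at h1
    rw [hh, mul_inv_rev, inv_inv] at h1
    rwa [hx x hxH _ (H.inv_mem h.2), hx y hyH _ (H.inv_mem h.2)] at h1
  · intro y
    refine ⟨⟨fun g => y (g⁻¹ : G), fun h hh => ?_⟩, ?_⟩
    · refine mem_stabilizer_iff.2 (funext fun g => ?_)
      change y (((h⁻¹ * g)⁻¹ : G) : G ⧸ H) = y ((g⁻¹ : G) : G ⧸ H)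
      congr 1
      rw [QuotientGroup.eq]
      simpa using H.inv_mem hh
    · ext a
      simp [f]

/-- A configuration fixed by `H` with larger stabilizer is also fixed by a representative of one of
the `H.index - 1` nontrivial cosets. Together with `H` this generates a subgroup of index at most
`H.index / 2`. -/
theorem pow_index_le_ncard_stabilizer_eq [Finite G] {A : Type*} [Finite A] (hA : 0 < Nat.card A)
    (H : Subgroup G) :
    Nat.card A ^ H.index ≤ {x : Config G A | stabilizer G x = H}.ncard +
      (H.index - 1) * Nat.card A ^ (H.index / 2) := by
  classical
  have := Fintype.ofFinite (G ⧸ H)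
  let T : Finset (G ⧸ H) := Finset.univ.erase ((1 : G) : G ⧸ H)
  have hT : T.card = H.index - 1 := by
    rw [Finset.card_erase_of_mem (Finset.mem_univ _), Finset.card_univ, Subgroup.index_eq_card,
      Nat.card_eq_fintype_card]
  let F : G ⧸ H → Set (Config G A) := fun a => {x | H ⊔ Subgroup.zpowers a.out ≤ stabilizer G x}
  have hF : ∀ a ∈ T, (F a).ncard ≤ Nat.card A ^ (H.index / 2) := by
    intro a ha
    rw [card_fixed_config]
    refine Nat.pow_le_pow_right hA ?_
    have h1 : H < H ⊔ Subgroup.zpowers a.out := by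
      refine lt_of_le_of_ne le_sup_left fun h => ?_
      have h2 : a.out ∈ H := by
        have h3 : a.out ∈ H ⊔ Subgroup.zpowers a.out :=
          Subgroup.mem_sup_right (Subgroup.mem_zpowers _)
        exact h.ge h3
      refine Finset.ne_of_mem_erase ha ?_
      refine (QuotientGroup.out_eq' a).symm.trans (Eq.symm ?_)
      rw [QuotientGroup.eq]
      simpa using h2
    have h2 := Subgroup.relIndex_mul_index h1.le
    have h3 : H.relIndex (H ⊔ Subgroup.zpowers a.out) ≠ 1 := by
      rw [Ne, Subgroup.relIndex_eq_one]
      exact not_le_of_gt h1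
    have h4 : H.relIndex (H ⊔ Subgroup.zpowers a.out) ≠ 0 := Subgroup.index_ne_zero_of_finite
    rw [Nat.le_div_iff_mul_le two_pos, ← h2, mul_comm]
    exact Nat.mul_le_mul_right _ (by omega)
  have hcover : {x : Config G A | H ≤ stabilizer G x} ⊆
      {x : Config G A | stabilizer G x = H} ∪ ⋃ a ∈ T, F a := by
    intro x hx
    by_cases h : stabilizer G x ≤ H
    · exact Or.inl (le_antisymm h hx)
    · obtain ⟨g, hg, hgH⟩ := Set.not_subset.1 h
      obtain ⟨k, hk⟩ := QuotientGroup.mk_out_eq_mul H g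
      refine Or.inr (Set.mem_biUnion (x := (g : G ⧸ H)) ?_ ?_)
      · refine Finset.mem_coe.2 (Finset.mem_erase.2 ⟨fun h => hgH ?_, Finset.mem_univ _⟩)
        rw [eq_comm, QuotientGroup.eq] at h
        simpa using h
      · refine sup_le (Set.mem_ofPred.1 hx) ?_
        rw [Subgroup.zpowers_le, hk]
        exact Subgroup.mul_mem _ hg (hx k.2)
  rw [← card_fixed_config (A := A) H, ← hT]
  calc _ ≤ _ := Set.ncard_le_ncard hcover (Set.toFinite _)
    _ ≤ _ := Set.ncard_union_le _ _
    _ ≤ _ := Nat.add_le_add_left ((Finset.set_ncard_biUnion_le T F).trans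
        (Finset.sum_le_card_nsmul T _ _ hF)) _

/-- With `t = c.rep.index ≥ |K|`, at most `2|K|` orbits would leave at most `2t²` configurations
with stabilizer `c.rep`, too few by `two_mul_sq_add_lt_pow`. -/
theorem two_mul_card_normalizerQuotient_lt [Finite G] {A : Type*} [Finite A] (hA : 2 ≤ Nat.card A)
    (c : SubgroupClass G) (hc : 8 ≤ Nat.card (NormalizerQuotient c.rep)) :
    2 * Nat.card (NormalizerQuotient c.rep) <
      Nat.card ((orbitReps G (Config G A)).orbits c) := by
  have hfin : Finite ((orbitReps G (Config G A)).orbits c) :=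
    inferInstanceAs (Finite {ω : orbitRel.Quotient G (Config G A) //
      Quotient.mk (subgroupConj G) (stabilizer G ω.out) = c})
  have h1 := (orbitReps G (Config G A)).ncard_stabilizer_eq_le c
  have h2 := pow_index_le_ncard_stabilizer_eq (by omega : 0 < Nat.card A) c.rep
  have h3 : Nat.card (NormalizerQuotient c.rep) ≤ c.rep.index :=
    Nat.le_of_dvd (Nat.pos_of_ne_zero Subgroup.index_ne_zero_of_finite)
      (Subgroup.relIndex_dvd_index_of_le Subgroup.le_normalizer)
  have h4 := two_mul_sq_add_lt_pow hA (hc.trans h3)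
  by_contra! h5
  change _ ≤ _ * Nat.card (NormalizerQuotient c.rep) at h1
  change Set.ncard {x : Config G A | stabilizer G x = c.rep} ≤ _ at h1
  generalize Nat.card (NormalizerQuotient c.rep) = k at *
  generalize Nat.card ((orbitReps G (Config G A)).orbits c) = i at *
  nlinarith [Nat.mul_le_mul h3 h3, Nat.mul_le_mul_right k h5]

end Counting

/-! ### Generators of each factor and the final sum -/

section Rank

open MulAction

attribute [local instance] arrowAction

theorem mem_shiftEnd_iff {G A : Type*} [Group G] [Finite G] (τ : Function.End (Config G A)) :
    τ ∈ ShiftEnd G A ↔ ∀ (g : G) (x : Config G A), τ (g • x) = g • τ x := by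
  refine ⟨fun h => h.2, fun h => ⟨?_, h⟩⟩
  let _ : TopologicalSpace A := ⊥
  have : DiscreteTopology A := ⟨rfl⟩
  exact continuous_of_discreteTopology (α := G → A)

theorem finite_shiftAut (G A : Type*) [Group G] [Finite G] [Finite A] : Finite (ShiftAut G A) := by
  have : Finite (Function.End (Config G A)) := inferInstanceAs (Finite (Config G A → Config G A))
  infer_instance

theorem exists_rank_eq {M : Type*} [Group M] [Finite M] :
    ∃ k : ℕ, rank M = k ∧ ∀ d, GenLE M d → k ≤ d := by
  obtain ⟨d, hd⟩ := genLE_of_finite (M := M)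
  have hne : rank M ≠ ⊤ := ne_top_of_le_ne_top (ENat.natCast_ne_top d) (rank_le_of_genLE hd)
  refine ⟨(rank M).toNat, (ENat.natCast_toNat hne).symm, fun e he => ?_⟩
  have h := rank_le_of_genLE he
  rw [← ENat.natCast_toNat hne] at h
  exact_mod_cast h

/-- Configurations fixed by all of `G` are constant. -/
theorem card_orbits_le_of_eq_top {G A : Type*} [Group G] [Finite A] {c : SubgroupClass G} (hc : c.rep = ⊤) :
    Nat.card ((orbitReps G (Config G A)).orbits c) ≤ Nat.card A := by
  let S := orbitReps G (Config G A)
  refine Nat.card_le_card_of_injective (fun i : S.orbits c => S.rep c i 1) fun i j hij => ?_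
  have hconst : ∀ (i : S.orbits c) (g : G), S.rep c i g = S.rep c i 1 := by
    intro i g
    have h1 : g ∈ stabilizer G (S.rep c i) := by
      rw [S.stabilizer_rep]
      exact hc.ge (Subgroup.mem_top g)
    have h2 : S.rep c i (g⁻¹ * g) = S.rep c i g := congrFun (mem_stabilizer_iff.1 h1) g
    rw [← h2, inv_mul_cancel]
  refine S.rep_injective c i j 1 ?_
  rw [one_smul]
  ext g
  rw [hconst i, hconst j]
  exact hij

theorem rep_mk_top {G : Type*} [Group G] : SubgroupClass.rep (Quotient.mk (subgroupConj G) ⊤) = ⊤ := by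
  obtain ⟨g, hg⟩ := exists_map_conj_eq_rep (⊤ : Subgroup G)
  rw [← hg]
  exact Subgroup.map_top_of_surjective _ (MulAut.conj g).surjective

theorem numClassesOfIndex_eq {G : Type*} [Group G] (i : ℕ) :
    numClassesOfIndex G i = Nat.card {c : SubgroupClass G // c.rep.index = i} := by
  refine Nat.card_congr (Equiv.subtypeEquivRight fun c => ⟨?_, fun h =>
    ⟨c.rep, h, Quotient.out_eq (s := subgroupConj G) c⟩⟩)
  rintro ⟨H, hH, rfl⟩
  obtain ⟨g, hg⟩ := exists_map_conj_eq_rep H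
  rw [← hg, ← hH]
  exact Subgroup.index_map_equiv H (MulAut.conj g)

theorem subsingleton_normalizerQuotient {G : Type*} [Group G] {H : Subgroup G} (h : H = ⊤) :
    Subsingleton (NormalizerQuotient H) := by
  subst h
  refine ⟨fun a b => ?_⟩
  obtain ⟨x, rfl⟩ := QuotientGroup.mk_surjective a
  obtain ⟨y, rfl⟩ := QuotientGroup.mk_surjective b
  exact QuotientGroup.eq.2 (Subgroup.mem_top _)

variable {G A : Type*} [Group G] [Finite G] [Finite A]

instance (c : SubgroupClass G) : Finite ((orbitReps G (Config G A)).orbits c) :=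
  inferInstanceAs (Finite {ω : orbitRel.Quotient G (Config G A) //
    Quotient.mk (subgroupConj G) (stabilizer G ω.out) = c})

instance : Finite (SubgroupClass G) := inferInstanceAs (Finite (Quotient (subgroupConj G)))

variable (A) in
/-- The wreath product attached to the configurations whose stabilizers belong to `c`. -/
abbrev ClassWreath (c : SubgroupClass G) : Type _ :=
  SymWreath ((orbitReps G (Config G A)).orbits c) (NormalizerQuotient c.rep)

theorem genLE_shiftAut [Fintype (SubgroupClass G)] {β : SubgroupClass G → ℕ}
    (h : ∀ c, GenLE (ClassWreath A c) (β c)) : GenLE (ShiftAut G A) (∑ c, β c) :=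
  (GenLE.pi h).of_surjective _
    ((orbitReps G (Config G A)).toHomUnits_surjective mem_shiftEnd_iff)

theorem genLE_classWreath {Ω : Type*} [Finite Ω] [MulAction G Ω] [FaithfulSMul G Ω]
    (hΩ : 4 ≤ Nat.card Ω) (hA : 2 ≤ Nat.card A) (c : SubgroupClass G) :
    GenLE (ClassWreath A c) (Nat.card Ω / 2 + 2) := by
  obtain ⟨d, hd, hcard⟩ := exists_genLE_two_pow_le (M := NormalizerQuotient c.rep)
  by_cases hle : d ≤ Nat.card Ω / 2
  · exact (hd.mono hle).symWreath
  -- Here `d > |Ω| / 2 ≥ 2`, so the quotient has order at least 8 and the orbit count applies.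
  · have h8 : 2 ^ 3 ≤ 2 ^ d := Nat.pow_le_pow_right two_pos (by omega)
    exact (genLE_abelianization (Ω := Ω) (QuotientGroup.mk' _)
      (QuotientGroup.mk'_surjective _)).symWreath_of_abelianization (by omega)
      (two_mul_card_normalizerQuotient_lt hA c (h8.trans hcard))

theorem genLE_classWreath_of_index_two {c : SubgroupClass G} (hc : c.rep.index = 2) :
    GenLE (ClassWreath A c) 3 := by
  refine (genLE_one_of_card_le_two ?_).symWreath
  exact Nat.le_of_dvd two_pos (hc ▸ Subgroup.relIndex_dvd_index_of_le Subgroup.le_normalizer)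

theorem genLE_classWreath_of_eq_top {c : SubgroupClass G} (hc : c.rep = ⊤) :
    GenLE (ClassWreath A c) 2 :=
  have := subsingleton_normalizerQuotient hc
  (GenLE.of_subsingleton 0).symWreath

theorem genLE_classWreath_of_eq_top_of_card_eq_two {c : SubgroupClass G} (hc : c.rep = ⊤)
    (hA : Nat.card A = 2) : GenLE (ClassWreath A c) 1 := by
  have := subsingleton_normalizerQuotient hc
  have h1 : GenLE (Equiv.Perm ((orbitReps G (Config G A)).orbits c)) 1 := by
    refine genLE_one_of_card_le_two ?_
    rw [Nat.card_perm]
    exact Nat.factorial_le (card_orbits_le_of_eq_top hc |>.trans hA.le)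
  refine h1.of_surjective SemidirectProduct.inr fun x => ⟨x.right, ?_⟩
  exact SemidirectProduct.ext (Subsingleton.elim _ _) rfl

/-- The class of `G` itself saves `|Ω| / 2` generators; the equation avoids natural-number
subtraction. -/
theorem genLE_shiftAut_of_three_le {Ω : Type*} [Finite Ω] [MulAction G Ω] [FaithfulSMul G Ω]
    (hΩ : 4 ≤ Nat.card Ω) (hA : 3 ≤ Nat.card A) :
    ∃ d, GenLE (ShiftAut G A) d ∧
      d + Nat.card Ω / 2 = numClasses G * (Nat.card Ω / 2 + 2) := by
  classical
  have := Fintype.ofFinite (SubgroupClass G)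
  let c₀ : SubgroupClass G := Quotient.mk (subgroupConj G) ⊤
  let β : SubgroupClass G → ℕ := fun c => if c = c₀ then 2 else Nat.card Ω / 2 + 2
  refine ⟨∑ c, β c, genLE_shiftAut fun c => ?_, ?_⟩
  · by_cases h : c = c₀
    · subst h
      simpa only [β, if_true] using genLE_classWreath_of_eq_top rep_mk_top
    · simpa only [β, if_neg h] using genLE_classWreath hΩ (by omega) c
  · have h1 : ∑ c, (β c + if c = c₀ then Nat.card Ω / 2 else 0) =
        ∑ _c : SubgroupClass G, (Nat.card Ω / 2 + 2) := by
      refine Finset.sum_congr rfl fun c _ => ?_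
      simp only [β]
      split_ifs <;> omega
    rw [Finset.sum_add_distrib, Finset.sum_ite_eq' Finset.univ c₀, if_pos (Finset.mem_univ _),
      Finset.sum_const, Finset.card_univ, smul_eq_mul] at h1
    rw [h1, numClasses, Nat.card_eq_fintype_card (α := SubgroupClass G)]

/-- The class of `G` saves `|Ω| / 2 + 1` generators and each class of index 2 saves one. -/
theorem genLE_shiftAut_of_eq_two {Ω : Type*} [Finite Ω] [MulAction G Ω] [FaithfulSMul G Ω]
    (hΩ : 4 ≤ Nat.card Ω) (hA : Nat.card A = 2) :
    ∃ d, GenLE (ShiftAut G A) d ∧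
      d + numClassesOfIndex G 2 + (Nat.card Ω / 2 + 1) = numClasses G * (Nat.card Ω / 2 + 2) := by
  classical
  have := Fintype.ofFinite (SubgroupClass G)
  let c₀ : SubgroupClass G := Quotient.mk (subgroupConj G) ⊤
  have hc₀ : c₀.rep = ⊤ := rep_mk_top
  let β : SubgroupClass G → ℕ := fun c =>
    if c = c₀ then 1 else if c.rep.index = 2 then Nat.card Ω / 2 + 1 else Nat.card Ω / 2 + 2
  refine ⟨∑ c, β c, genLE_shiftAut fun c => ?_, ?_⟩
  · by_cases h : c = c₀
    · subst h
      simpa only [β, if_true] using genLE_classWreath_of_eq_top_of_card_eq_two hc₀ hA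
    · by_cases h2 : c.rep.index = 2
      · simpa only [β, if_neg h, if_pos h2] using
          (genLE_classWreath_of_index_two h2).mono (by omega)
      · simpa only [β, if_neg h, if_neg h2] using genLE_classWreath hΩ (by omega) c
  · have h1 : ∑ c, (β c + (if c.rep.index = 2 then 1 else 0) +
        if c = c₀ then Nat.card Ω / 2 + 1 else 0) =
        ∑ _c : SubgroupClass G, (Nat.card Ω / 2 + 2) := by
      refine Finset.sum_congr rfl fun c _ => ?_
      by_cases h : c = c₀
      · have : c.rep.index ≠ 2 := by
          rw [h, hc₀, Subgroup.index_top]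
          omega
        simp only [β, if_pos h, if_neg this]
        omega
      · simp only [β, if_neg h]
        split_ifs <;> omega
    rw [Finset.sum_add_distrib, Finset.sum_add_distrib, Finset.sum_ite_eq' Finset.univ c₀,
      if_pos (Finset.mem_univ _), Finset.sum_const, Finset.card_univ, smul_eq_mul,
      ← Finset.card_filter, ← Fintype.card_subtype] at h1
    rw [numClassesOfIndex_eq, numClasses, Nat.card_eq_fintype_card (α := SubgroupClass G),
      Nat.card_eq_fintype_card (α := {c : SubgroupClass G // c.rep.index = 2}), ← h1]

end Rank

end FullShift

theorem mainTheorem6 (n : ℕ) (hn : 3 < n) (G : Subgroup (Equiv.Perm (Fin n)))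
    (A : Type*) [Finite A] :
    ∃ k : ℕ, FullShift.rank (FullShift.ShiftAut G A) = (k : ℕ∞) ∧
      (Nat.card A = 2 →
        (k : ℤ) ≤ ((FullShift.numClasses G : ℤ) - 1) * ⌊(n : ℚ) / 2⌋
          + 2 * (FullShift.numClasses G : ℤ) - (FullShift.numClassesOfIndex G 2 : ℤ) - 1) ∧
      (3 ≤ Nat.card A →
        (k : ℤ) ≤ ((FullShift.numClasses G : ℤ) - 1) * ⌊(n : ℚ) / 2⌋
          + 2 * (FullShift.numClasses G : ℤ)) := by
  have := FullShift.finite_shiftAut G A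
  obtain ⟨k, hk, hle⟩ := FullShift.exists_rank_eq (M := FullShift.ShiftAut G A)
  have hfloor : ⌊(n : ℚ) / 2⌋ = ((n / 2 : ℕ) : ℤ) := by
    have h := Rat.floor_intCast_div_natCast (n : ℤ) 2
    push_cast at h ⊢
    exact h
  have hΩ : 4 ≤ Nat.card (Fin n) := by rw [Nat.card_fin]; exact hn
  rw [hfloor]
  refine ⟨k, hk, fun hA => ?_, fun hA => ?_⟩
  · obtain ⟨d, hd, hsum⟩ := FullShift.genLE_shiftAut_of_eq_two (G := G) (A := A) hΩ hA
    have hkd := hle d hd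
    rw [Nat.card_fin] at hsum
    zify at hsum hkd ⊢
    linarith
  · obtain ⟨d, hd, hsum⟩ := FullShift.genLE_shiftAut_of_three_le (G := G) (A := A) hΩ hA
    have hkd := hle d hd
    rw [Nat.card_fin] at hsum
    zify at hsum hkd ⊢
    linarith
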